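/- Let $\Bbbk$ be a field, let $n\ge 4$, let $r_1,\dots,r_n\ge 2$ be integers, let $t\in\{1,\dots,n\}$, and put $\mathcal N=[r_1]\times\cdots\times[r_n]$, where $[r]=\{1,\dots,r\}$. Let $R=\Bbbk[x_a : a\in\mathcal N]$ be the polynomial ring in variables $x_a$ subject only to the identification that $x_a=x_b$ if and only if $a_1+\cdots+a_{n-1}=b_1+\cdots+b_{n-1}$ and $a_n=b_n$. For $a,b\in\mathcal N$ let $\mathrm d(a,b)$ be the number of components in which $a$ and $b$ differ, and for $i\in[n]$ let $\mathrm{sw}(i,a,b)$ be the index obtained from $a$ by replacing its $i$-th component by $b_i$. Put $$f_{i,a,b}=x_ax_b-x_{\mathrm{sw}(i,a,b)}\,x_{\mathrm{sw}(i,b,a)}$$ and consider the ideals of $R$ $$I^{(n-1,t)}=\big(f_{i,a,b} : a,b\in\mathcal N,\ \mathrm d(a,b)=2,\ i\in[t]\big),\qquad \tilde I^{(n-1,t)}=\big(f_{i,a,b} : a,b\in\mathcal N,\ i\in[t]\big).$$ **Theorem.** The ideal $I^{(n-1,t)}$ has exactly two minimal primes: the ideal $\tilde I^{(n-1,t)}$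 and the monomial prime $$P=\big(x_a : a\in\mathcal N,\ (a_1,\dots,a_{n-1})\notin\{(1,\dots,1),(r_1,\dots,r_{n-1})\}\big).$$ -/

import Mathlib

namespace SHankel

/-- The set of indices `[r₁] × ⋯ × [rₙ]`: the tuples `a` of integers with `1 ≤ a i ≤ r i`.
The position `i : Fin n` stands for the `(i + 1)`-st component. -/
abbrev Index {n : ℕ} (r : Fin n → ℕ) : Type :=
  {a : Fin n → ℕ // ∀ i, 1 ≤ a i ∧ a i ≤ r i}

/-- Two indices are `s`-equivalent if the sums of their first `s` components agree and their
remaining components agree. -/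
def SEquiv {n : ℕ} (r : Fin n → ℕ) (s : ℕ) (a b : Index r) : Prop :=
  (∑ i : Fin n with i.val < s, a.1 i) = (∑ i : Fin n with i.val < s, b.1 i) ∧
    ∀ i : Fin n, s ≤ i.val → a.1 i = b.1 i

/-- `s`-equivalence as a setoid. -/
def sSetoid {n : ℕ} (r : Fin n → ℕ) (s : ℕ) : Setoid (Index r) where
  r := SEquiv r s
  iseqv :=
    { refl := fun _ => ⟨rfl, fun _ _ => rfl⟩
      symm := fun h => ⟨h.1.symm, fun i hi => (h.2 i hi).symm⟩
      trans := fun h k => ⟨h.1.trans k.1, fun i hi => (h.2 i hi).trans (k.2 i hi)⟩ }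

/-- The polynomial ring over `𝕜` with one variable for each `s`-equivalence class of indices. -/
abbrev Ring {n : ℕ} (𝕜 : Type*) [Field 𝕜] (r : Fin n → ℕ) (s : ℕ) : Type _ :=
  MvPolynomial (Quotient (sSetoid r s)) 𝕜

/-- The `a`-entry `x_a` of the `s`-Hankel hypermatrix; `x_a = x_b` exactly when `a` and `b` are
`s`-equivalent. -/
noncomputable def entry {n : ℕ} (𝕜 : Type*) [Field 𝕜] (r : Fin n → ℕ) (s : ℕ) (a : Index r) :
    Ring 𝕜 r s :=
  MvPolynomial.X (Quotient.mk (sSetoid r s) a)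

/-- The switch `sw(L, a, b)`: the components in `L` are taken from `b`, the others from `a`. -/
def switch {n : ℕ} {r : Fin n → ℕ} (L : Finset (Fin n)) (a b : Index r) : Index r :=
  ⟨fun i => if i ∈ L then b.1 i else a.1 i, fun i => by
    by_cases h : i ∈ L
    · simpa only [if_pos h] using b.2 i
    · simpa only [if_neg h] using a.2 i⟩

/-- The Hamming distance of two indices: the number of components in which they differ. -/
def dist {n : ℕ} {r : Fin n → ℕ} (a b : Index r) : ℕ := hammingDist a.1 b.1

/-- The polynomial `f_{i,a,b} = x_a x_b - x_{sw(i,a,b)} x_{sw(i,b,a)}`. -/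
noncomputable def minor {n : ℕ} (𝕜 : Type*) [Field 𝕜] (r : Fin n → ℕ) (s : ℕ) (i : Fin n)
    (a b : Index r) : Ring 𝕜 r s :=
  entry 𝕜 r s a * entry 𝕜 r s b -
    entry 𝕜 r s (switch {i} a b) * entry 𝕜 r s (switch {i} b a)

/-- The ideal `I^{(s,t)}` generated by the `f_{i,a,b}` with `d(a,b) = 2` and `i` among the first
`t` positions. -/
noncomputable def sliceIdeal {n : ℕ} (𝕜 : Type*) [Field 𝕜] (r : Fin n → ℕ) (s t : ℕ) :
    Ideal (Ring 𝕜 r s) :=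
  Ideal.span {f | ∃ (i : Fin n) (a b : Index r),
    i.val < t ∧ dist a b = 2 ∧ f = minor 𝕜 r s i a b}

/-- The ideal `Ĩ^{(s,t)}` generated by all the `f_{i,a,b}` with `i` among the first `t`
positions. -/
noncomputable def generalizedIdeal {n : ℕ} (𝕜 : Type*) [Field 𝕜] (r : Fin n → ℕ) (s t : ℕ) :
    Ideal (Ring 𝕜 r s) :=
  Ideal.span {f | ∃ (i : Fin n) (a b : Index r), i.val < t ∧ f = minor 𝕜 r s i a b}

/-- The ideal generated by the variables `x_a` with
`(a₁, …, aₛ) ∉ {(1, …, 1), (r₁, …, rₛ)}`. -/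
noncomputable def monomialIdeal {n : ℕ} (𝕜 : Type*) [Field 𝕜] (r : Fin n → ℕ) (s : ℕ) :
    Ideal (Ring 𝕜 r s) :=
  Ideal.span {f | ∃ a : Index r,
    ¬ (∀ i : Fin n, i.val < s → a.1 i = 1) ∧
    ¬ (∀ i : Fin n, i.val < s → a.1 i = r i) ∧ f = entry 𝕜 r s a}

end SHankel

/-! An entry depends only on its weight `p`, the sum of all components but the last, and on its last
component `c`. So the variables form a table `x_{p,c}` with `lo ≤ p ≤ hi`, where `lo = n - 1` and
`hi = r₁ + ⋯ + r_{n-1}`, and `P` is generated by the rows strictly between the extremes.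

The slice ideal contains `x_{p,c} x_{p+2,c} - x_{p+1,c}²` and `x_{p,c} x_{p+1,d} - x_{p+1,c}
x_{p,d}`. If a prime `Q` over it misses an interior variable, these relations force `x_{p,c} = z ^ p
* v c` in the fraction field of the quotient by `Q` (`exists_geometric`), and every `f_{i,a,b}`
vanishes on such a table. Hence `Q` contains `Ĩ` or `P`.

Both are primes over the slice ideal: `Ĩ` is the kernel of `x_{p,c} ↦ T ^ p * y_c`
(`generalizedIdeal_eq_ker`), and two corner indices are never at distance 2 when `n ≥ 4`. Neither
contains the other, so they are the minimal primes. -/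

namespace SHankel

open MvPolynomial

/-! ### Indices, weights and the table of variables -/

/-- An interval of natural numbers is attained by sums with prescribed bounds on the summands. -/
theorem exists_fun_sum_eq {N : ℕ} (l h : Fin N → ℕ) (hlh : ∀ i, l i ≤ h i) (w : ℕ)
    (hl : ∑ i, l i ≤ w) (hh : w ≤ ∑ i, h i) :
    ∃ f : Fin N → ℕ, (∀ i, l i ≤ f i ∧ f i ≤ h i) ∧ ∑ i, f i = w := by
  induction N generalizing w with
  | zero => exact ⟨l, fun i => i.elim0, by simp at hh ⊢; omega⟩
  | succ N ih =>
    rw [Fin.sum_univ_succ] at hl hh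
    have hle : ∑ i : Fin N, l i.succ ≤ ∑ i : Fin N, h i.succ :=
      Finset.sum_le_sum fun i _ => hlh i.succ
    have h0 := hlh 0
    -- Greedy choice: the first summand is as large as its bound and the lower bounds of the others
    -- allow.
    obtain ⟨f, hf, hs⟩ := ih (fun i => l i.succ) (fun i => h i.succ) (fun i => hlh i.succ)
      (w - min (h 0) (w - ∑ i : Fin N, l i.succ)) (by omega) (by omega)
    refine ⟨Fin.cons (min (h 0) (w - ∑ i : Fin N, l i.succ)) f, fun i => ?_, ?_⟩
    · refine Fin.cases ?_ (fun j => ?_) i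
      · simp only [Fin.cons_zero]; omega
      · simpa using hf j
    · rw [Fin.sum_univ_succ]
      simp only [Fin.cons_zero, Fin.cons_succ, hs]
      omega

/-- The sum of all components but the last. -/
def weight {m : ℕ} {r : Fin (m + 1) → ℕ} (a : Index r) : ℕ := ∑ i : Fin m, a.1 i.castSucc

theorem sum_filter_lt_eq {m : ℕ} (f : Fin (m + 1) → ℕ) :
    ∑ i : Fin (m + 1) with i.val < m, f i = ∑ i : Fin m, f i.castSucc := by
  rw [Finset.sum_filter, Fin.sum_univ_castSucc]
  simp

theorem sEquiv_iff {m : ℕ} {r : Fin (m + 1) → ℕ} (a b : Index r) :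
    SEquiv r m a b ↔ weight a = weight b ∧ a.1 (Fin.last m) = b.1 (Fin.last m) := by
  unfold SEquiv weight
  rw [sum_filter_lt_eq, sum_filter_lt_eq]
  refine and_congr_right fun _ => ⟨fun h => h _ le_rfl, fun h i hi => ?_⟩
  obtain rfl : i = Fin.last m := Fin.ext (by have := i.2; simp; omega)
  exact h

theorem entry_eq_entry {m : ℕ} (𝕜 : Type*) [Field 𝕜] {r : Fin (m + 1) → ℕ} {a b : Index r}
    (hw : weight a = weight b) (hc : a.1 (Fin.last m) = b.1 (Fin.last m)) :
    entry 𝕜 r m a = entry 𝕜 r m b := by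
  unfold entry
  congr 1
  exact Quotient.sound ((sEquiv_iff a b).2 ⟨hw, hc⟩)

/-- The weight of a class of indices. -/
def classWeight {m : ℕ} {r : Fin (m + 1) → ℕ} : Quotient (sSetoid r m) → ℕ :=
  Quotient.lift weight fun a b h => ((sEquiv_iff a b).1 h).1

/-- The last component of a class of indices. -/
def classCol {m : ℕ} {r : Fin (m + 1) → ℕ} : Quotient (sSetoid r m) → ℕ :=
  Quotient.lift (fun a : Index r => a.1 (Fin.last m)) fun a b h => ((sEquiv_iff a b).1 h).2

open Classical in
/-- The variable in row `p` and column `c`, or zero if there is none. -/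
noncomputable def var {m : ℕ} (𝕜 : Type*) [Field 𝕜] (r : Fin (m + 1) → ℕ) (p c : ℕ) :
    Ring 𝕜 r m :=
  if h : ∃ a : Index r, weight a = p ∧ a.1 (Fin.last m) = c then entry 𝕜 r m h.choose else 0

theorem entry_eq_var {m : ℕ} (𝕜 : Type*) [Field 𝕜] {r : Fin (m + 1) → ℕ} {a : Index r}
    {p c : ℕ} (hw : weight a = p) (hc : a.1 (Fin.last m) = c) :
    entry 𝕜 r m a = var 𝕜 r p c := by
  have h : ∃ a : Index r, weight a = p ∧ a.1 (Fin.last m) = c := ⟨a, hw, hc⟩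
  rw [var, dif_pos h]
  exact entry_eq_entry 𝕜 (hw.trans h.choose_spec.1.symm) (hc.trans h.choose_spec.2.symm)

/-- The additive form avoids truncated subtraction; adding the instances for `(a, b)` and `(b, a)`
shows that a switch conserves total weight. -/
theorem weight_switch {m : ℕ} {r : Fin (m + 1) → ℕ} (i : Fin m) (a b : Index r) :
    weight (switch {i.castSucc} a b) + a.1 i.castSucc = weight a + b.1 i.castSucc := by
  unfold weight switch
  simp only [Finset.mem_singleton, Fin.castSucc_inj]
  rw [← Finset.add_sum_erase _ _ (Finset.mem_univ i),
    ← Finset.add_sum_erase _ (fun j : Fin m => a.1 j.castSucc) (Finset.mem_univ i)]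
  have : ∑ x ∈ Finset.univ.erase i, (if x = i then b.1 x.castSucc else a.1 x.castSucc) =
      ∑ x ∈ Finset.univ.erase i, a.1 x.castSucc :=
    Finset.sum_congr rfl fun x hx => if_neg (Finset.ne_of_mem_erase hx)
  rw [this]
  simp only [if_true]
  omega

theorem switch_castSucc_last {m : ℕ} {r : Fin (m + 1) → ℕ} (i : Fin m) (a b : Index r) :
    (switch {i.castSucc} a b).1 (Fin.last m) = a.1 (Fin.last m) := by
  simp [switch, (Fin.castSucc_lt_last i).ne']

theorem switch_last_last {m : ℕ} {r : Fin (m + 1) → ℕ} (a b : Index r) :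
    (switch {Fin.last m} a b).1 (Fin.last m) = b.1 (Fin.last m) := by
  simp [switch]

theorem weight_switch_last {m : ℕ} {r : Fin (m + 1) → ℕ} (a b : Index r) :
    weight (switch {Fin.last m} a b) = weight a := by
  simp [weight, switch, (Fin.castSucc_lt_last _).ne]

theorem le_weight {m : ℕ} {r : Fin (m + 1) → ℕ} (a : Index r) : m ≤ weight a := by
  simpa [weight] using
    Finset.sum_le_sum fun (i : Fin m) (_ : i ∈ Finset.univ) => (a.2 i.castSucc).1

theorem weight_le {m : ℕ} {r : Fin (m + 1) → ℕ} (a : Index r) :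
    weight a ≤ ∑ i : Fin m, r i.castSucc :=
  Finset.sum_le_sum fun i _ => (a.2 i.castSucc).2

/-- Entries of the form `z ^ weight * v` satisfy all the quadratic relations. -/
theorem minor_relation_of_geometric {m : ℕ} {r : Fin (m + 1) → ℕ} {K : Type*} [CommRing K]
    (y : Index r → K) (z : K) (v : ℕ → K)
    (hy : ∀ a, y a = z ^ weight a * v (a.1 (Fin.last m))) (i : Fin (m + 1)) (a b : Index r) :
    y a * y b - y (switch {i} a b) * y (switch {i} b a) = 0 := by
  simp only [hy]
  induction i using Fin.lastCases with
  | last =>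
    simp only [weight_switch_last, switch_last_last]
    ring
  | cast i =>
    simp only [switch_castSucc_last]
    have h1 := weight_switch i a b
    have h2 := weight_switch i b a
    have h3 : weight (switch {i.castSucc} a b) + weight (switch {i.castSucc} b a) =
      weight a + weight b := by omega
    have h4 := congrArg (z ^ ·) h3
    simp only [pow_add] at h4
    linear_combination (-v (a.1 (Fin.last m)) * v (b.1 (Fin.last m))) * h4

/-- There is an index with given first component, given last component, and given sum of the
others. -/
theorem exists_index {k : ℕ} (r : Fin (k + 2) → ℕ) (hr : ∀ i, 1 ≤ r i) (x u c : ℕ)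
    (hx : 1 ≤ x) (hx' : x ≤ r 0) (hc : 1 ≤ c) (hc' : c ≤ r (Fin.last _))
    (hu : k ≤ u) (hu' : u ≤ ∑ i : Fin k, r i.succ.castSucc) :
    ∃ a : Index r, a.1 0 = x ∧ a.1 (Fin.last _) = c ∧ weight a = x + u := by
  obtain ⟨f, hf, hs⟩ := exists_fun_sum_eq (fun _ => 1) (fun i : Fin k => r i.succ.castSucc)
    (fun i => hr _) u (by simpa using hu) hu'
  let g : Fin (k + 2) → ℕ := Fin.snoc (α := fun _ => ℕ) (Fin.cons (α := fun _ => ℕ) x f) c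
  have hg0 : g (Fin.castSucc 0) = x := by simp only [g, Fin.snoc_castSucc, Fin.cons_zero]
  have hgs : ∀ i : Fin k, g i.succ.castSucc = f i := fun i => by
    simp only [g, Fin.snoc_castSucc, Fin.cons_succ]
  have hgl : g (Fin.last _) = c := by simp only [g, Fin.snoc_last]
  refine ⟨⟨g, fun i => ?_⟩, hg0, hgl, ?_⟩
  · induction i using Fin.lastCases with
    | last => rw [hgl]; exact ⟨hc, hc'⟩
    | cast i =>
      induction i using Fin.cases with
      | zero => rw [hg0]; exact ⟨hx, hx'⟩
      | succ i => rw [hgs]; exact hf i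
  · simp only [weight]
    rw [Fin.sum_univ_succ]
    simp only [hg0, hgs, hs]

/-- There is an index with given weight and last component. -/
theorem exists_index_weight {m : ℕ} (r : Fin (m + 1) → ℕ) (hr : ∀ i, 1 ≤ r i) (p c : ℕ)
    (hc : 1 ≤ c) (hc' : c ≤ r (Fin.last _))
    (hp : m ≤ p) (hp' : p ≤ ∑ i : Fin m, r i.castSucc) :
    ∃ a : Index r, a.1 (Fin.last _) = c ∧ weight a = p := by
  obtain ⟨f, hf, hs⟩ := exists_fun_sum_eq (fun _ => 1) (fun i : Fin m => r i.castSucc)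
    (fun i => hr _) p (by simpa using hp) hp'
  refine ⟨⟨Fin.snoc (α := fun _ => ℕ) f c, fun i => ?_⟩, by simp, ?_⟩
  · induction i using Fin.lastCases with
    | last => simpa using ⟨hc, hc'⟩
    | cast i => simpa using hf i
  · simpa [weight] using hs

/-! ### Quadratic relations between the variables -/

/-- The relation between neighbouring products of variables in the generalized ideal. -/
theorem var_exchange_mem_generalizedIdeal {k : ℕ} (𝕜 : Type*) [Field 𝕜] (r : Fin (k + 3) → ℕ)
    (hr : ∀ i, 2 ≤ r i) (t : ℕ) (ht : 1 ≤ t) (p q c d : ℕ)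
    (hp : k + 2 ≤ p) (hp' : p < ∑ i : Fin (k + 2), r i.castSucc)
    (hq : k + 2 < q) (hq' : q ≤ ∑ i : Fin (k + 2), r i.castSucc)
    (hc : 1 ≤ c) (hc' : c ≤ r (Fin.last _)) (hd : 1 ≤ d) (hd' : d ≤ r (Fin.last _)) :
    var 𝕜 r p c * var 𝕜 r q d - var 𝕜 r (p + 1) c * var 𝕜 r (q - 1) d ∈
      generalizedIdeal 𝕜 r (k + 2) t := by
  have hr1 : ∀ i, 1 ≤ r i := fun i => one_le_two.trans (hr i)
  have hr0 := hr 0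
  have hK : 2 * (k + 1) ≤ ∑ i : Fin (k + 1), r i.succ.castSucc := by
    simpa [mul_comm] using Finset.sum_le_sum
      fun (i : Fin (k + 1)) (_ : i ∈ Finset.univ) => hr i.succ.castSucc
  rw [Fin.sum_univ_succ, Fin.castSucc_zero] at hp' hq'
  set K := ∑ i : Fin (k + 1), r i.succ.castSucc with hKdef
  -- Generator exchanging the first components `x` and `y` of two indices whose other components but
  -- the last sum to `u` and `v`.
  have key : ∀ x y u v : ℕ, 1 ≤ x → x ≤ r 0 → 1 ≤ y → y ≤ r 0 → k + 1 ≤ u → u ≤ K →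
      k + 1 ≤ v → v ≤ K → var 𝕜 r (x + u) c * var 𝕜 r (y + v) d -
        var 𝕜 r (y + u) c * var 𝕜 r (x + v) d ∈ generalizedIdeal 𝕜 r (k + 2) t := by
    intro x y u v hx hx' hy hy' hu hu' hv hv'
    obtain ⟨a, ha0, hal, haw⟩ := exists_index r hr1 x u c hx hx' hc hc' hu hu'
    obtain ⟨b, hb0, hbl, hbw⟩ := exists_index r hr1 y v d hy hy' hd hd' hv hv'
    have h1 := weight_switch 0 a b
    have h2 := weight_switch 0 b a
    have h3 := switch_castSucc_last 0 a b
    have h4 := switch_castSucc_last 0 b a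
    rw [Fin.castSucc_zero] at h1 h2 h3 h4
    refine Ideal.subset_span ⟨0, a, b, Nat.lt_of_lt_of_le Nat.zero_lt_one ht, ?_⟩
    rw [minor, entry_eq_var 𝕜 haw hal, entry_eq_var 𝕜 hbw hbl,
      entry_eq_var 𝕜 (p := y + u) (by omega) (h3.trans hal),
      entry_eq_var 𝕜 (p := x + v) (by omega) (h4.trans hbl)]
  -- One switch moving exactly one unit of weight need not exist. Replacing `(x, v)` by `(x + 1, v -
  -- 1)` leaves the switched product unchanged, so the difference of the two generators is the
  -- desired binomial.
  have e1 := key (p - min (p - 1) K) (q - min (q - 1) K) (min (p - 1) K) (min (q - 1) K)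
    (by omega) (by omega) (by omega) (by omega) (by omega) (by omega) (by omega) (by omega)
  have e2 := key (p + 1 - min (p - 1) K) (q - min (q - 1) K) (min (p - 1) K)
    (min (q - 1) K - 1)
    (by omega) (by omega) (by omega) (by omega) (by omega) (by omega) (by omega) (by omega)
  rw [show p - min (p - 1) K + min (p - 1) K = p by omega,
    show q - min (q - 1) K + min (q - 1) K = q by omega] at e1
  rw [show p + 1 - min (p - 1) K + min (p - 1) K = p + 1 by omega,
    show q - min (q - 1) K + (min (q - 1) K - 1) = q - 1 by omega,
    show p + 1 - min (p - 1) K + (min (q - 1) K - 1) =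
      p - min (p - 1) K + min (q - 1) K by omega] at e2
  simpa using Ideal.sub_mem _ e1 e2

/-- The relation between rows `p` and `p + 1` of two columns. -/
theorem var_row_mem_sliceIdeal {k : ℕ} (𝕜 : Type*) [Field 𝕜] (r : Fin (k + 2) → ℕ)
    (hr : ∀ i, 2 ≤ r i) (t : ℕ) (ht : 1 ≤ t) (p c d : ℕ)
    (hp : k + 1 ≤ p) (hp' : p < ∑ i : Fin (k + 1), r i.castSucc)
    (hc : 1 ≤ c) (hc' : c ≤ r (Fin.last _)) (hd : 1 ≤ d) (hd' : d ≤ r (Fin.last _)) :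
    var 𝕜 r p c * var 𝕜 r (p + 1) d - var 𝕜 r (p + 1) c * var 𝕜 r p d ∈
      sliceIdeal 𝕜 r (k + 1) t := by
  rcases eq_or_ne c d with rfl | hcd
  · simp [mul_comm]
  have hr1 : ∀ i, 1 ≤ r i := fun i => one_le_two.trans (hr i)
  have hr0 := hr 0
  have hK : k ≤ ∑ i : Fin k, r i.succ.castSucc := by
    simpa using Finset.sum_le_sum
      fun (i : Fin k) (_ : i ∈ Finset.univ) => hr1 i.succ.castSucc
  rw [Fin.sum_univ_succ, Fin.castSucc_zero] at hp'
  -- The first component is as small as possible; since `p` is not maximal it stays below `r 0` and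
  -- can be raised by one in `b`.
  obtain ⟨a, ha0, hal, haw⟩ := exists_index r hr1
    (p - min (p - 1) (∑ i : Fin k, r i.succ.castSucc))
    (min (p - 1) (∑ i : Fin k, r i.succ.castSucc)) c
    (by omega) (by omega) hc hc' (by omega) (by omega)
  rw [Nat.sub_add_cancel (by omega)] at haw
  let b : Index r := ⟨fun i => if i = 0 then a.1 0 + 1 else if i = Fin.last _ then d else a.1 i,
    fun i => by
      dsimp only
      split_ifs with h h'
      · subst h; omega
      · subst h'; omega
      · exact a.2 i⟩
  have hb0 : b.1 0 = a.1 0 + 1 := by simp [b]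
  have hbl : b.1 (Fin.last _) = d := by simp [b]
  have hbs : ∀ i : Fin k, b.1 i.succ.castSucc = a.1 i.succ.castSucc := fun i => by
    simp [b, (Fin.castSucc_lt_last _).ne]
  have hbw : weight b = p + 1 := by
    rw [← haw, weight, weight, Fin.sum_univ_succ, Fin.sum_univ_succ]
    simp only [hbs, Fin.castSucc_zero, hb0]
    omega
  have hdist : dist a b = 2 := by
    rw [dist, hammingDist, show ({i | a.1 i ≠ b.1 i} : Finset _) = {0, Fin.last (k + 1)} from ?_]
    · exact Finset.card_pair (by simp [Fin.ext_iff])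
    · ext i
      simp only [Finset.mem_filter, Finset.mem_univ, true_and, Finset.mem_insert,
        Finset.mem_singleton]
      induction i using Fin.lastCases with
      | last => simp [hal, hbl, hcd]
      | cast i =>
        induction i using Fin.cases with
        | zero => simp [hb0]
        | succ i =>
          exact iff_of_false (fun h => h (hbs i).symm)
            (not_or.2 ⟨by simp [Fin.ext_iff], (Fin.castSucc_lt_last _).ne⟩)
  have h1 := weight_switch 0 a b
  have h2 := weight_switch 0 b a
  have h3 := switch_castSucc_last 0 a b
  have h4 := switch_castSucc_last 0 b a
  rw [Fin.castSucc_zero] at h1 h2 h3 h4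
  refine Ideal.subset_span ⟨0, a, b, Nat.lt_of_lt_of_le Nat.zero_lt_one ht, hdist, ?_⟩
  rw [minor, entry_eq_var 𝕜 haw hal, entry_eq_var 𝕜 hbw hbl,
    entry_eq_var 𝕜 (p := p + 1) (by omega) (h3.trans hal),
    entry_eq_var 𝕜 (p := p) (by omega) (h4.trans hbl)]

/-- The relation between three consecutive rows of a column. -/
theorem var_diag_mem_sliceIdeal {k : ℕ} (𝕜 : Type*) [Field 𝕜] (r : Fin (k + 3) → ℕ)
    (hr : ∀ i, 2 ≤ r i) (t : ℕ) (ht : 1 ≤ t) (p c : ℕ)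
    (hp : k + 2 ≤ p) (hp' : p + 2 ≤ ∑ i : Fin (k + 2), r i.castSucc)
    (hc : 1 ≤ c) (hc' : c ≤ r (Fin.last _)) :
    var 𝕜 r p c * var 𝕜 r (p + 2) c - var 𝕜 r (p + 1) c * var 𝕜 r (p + 1) c ∈
      sliceIdeal 𝕜 r (k + 2) t := by
  -- Lowering the first two bounds by one leaves room to raise both components in `b`; switching one
  -- of them then gives two indices of weight `p + 1`.
  let r' : Fin (k + 3) → ℕ := fun i => if i = 0 ∨ i = 1 then r i - 1 else r i
  have hr0 := hr 0
  have hr1 := hr 1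
  have hr'0 : r' 0 = r 0 - 1 := by simp [r']
  have hr'1 : r' 1 = r 1 - 1 := by simp [r']
  have h01 : (0 : Fin (k + 3)) ≠ 1 := by simp
  have hss : ∀ i : Fin k, i.succ.succ.castSucc ≠ 0 ∧ i.succ.succ.castSucc ≠ 1 := fun i => by
    constructor <;> simp [Fin.ext_iff]
  have hl : Fin.last (k + 2) ≠ 0 ∧ Fin.last (k + 2) ≠ 1 := by
    constructor <;> simp [Fin.ext_iff]
  have hle : ∀ i, r' i ≤ r i := fun i => by simp only [r']; split_ifs <;> omega
  have hsum : ∀ f : Fin (k + 3) → ℕ, ∑ i : Fin (k + 2), f i.castSucc =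
      f 0 + (f 1 + ∑ i : Fin k, f i.succ.succ.castSucc) := fun f => by
    rw [Fin.sum_univ_succ, Fin.sum_univ_succ]; rfl
  have hrs : ∑ i : Fin (k + 2), r' i.castSucc + 2 = ∑ i : Fin (k + 2), r i.castSucc := by
    rw [hsum, hsum, hr'0, hr'1]
    simp only [r', hss, or_self, if_false]
    omega
  obtain ⟨a', hal, haw⟩ := exists_index_weight r' (fun i => by
    have := hr i
    simp only [r']; split_ifs <;> omega) p c hc (by simpa [r', hl] using hc') hp (by omega)
  have ha0 := (a'.2 0).2
  have ha1 := (a'.2 1).2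
  rw [hr'0] at ha0
  rw [hr'1] at ha1
  let a : Index r := ⟨a'.1, fun i => ⟨(a'.2 i).1, (a'.2 i).2.trans (hle i)⟩⟩
  let b : Index r := ⟨fun i => if i = 0 ∨ i = 1 then a'.1 i + 1 else a'.1 i, fun i => by
    have := a'.2 i
    have := hle i
    dsimp only
    split_ifs with h
    · rcases h with rfl | rfl <;> omega
    · omega⟩
  change weight a = p at haw
  change a.1 _ = c at hal
  have hb0 : b.1 0 = a.1 0 + 1 := by simp [a, b]
  have hb1 : b.1 1 = a.1 1 + 1 := by simp [a, b]
  have hbl : b.1 (Fin.last _) = c := by simpa [b, hl] using hal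
  have hbw : weight b = p + 2 := by
    rw [← haw, weight, weight, hsum, hsum, hb0, hb1]
    have : ∀ i : Fin k, b.1 i.succ.succ.castSucc = a.1 i.succ.succ.castSucc := fun i =>
      if_neg (c := i.succ.succ.castSucc = 0 ∨ i.succ.succ.castSucc = 1)
        (t := a'.1 i.succ.succ.castSucc + 1) (not_or.2 (hss i))
    simp only [this]
    omega
  have hdist : dist a b = 2 := by
    rw [dist, hammingDist, show ({i | a.1 i ≠ b.1 i} : Finset _) = {0, 1} from ?_]
    · exact Finset.card_pair h01
    · ext i
      simp only [Finset.mem_filter, Finset.mem_univ, true_and, Finset.mem_insert,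
        Finset.mem_singleton]
      by_cases h : i = 0 ∨ i = 1
      · simp [a, b, h]
      · simp [a, b, h]
  have h1 := weight_switch 0 a b
  have h2 := weight_switch 0 b a
  have h3 := switch_castSucc_last 0 a b
  have h4 := switch_castSucc_last 0 b a
  rw [Fin.castSucc_zero] at h1 h2 h3 h4
  refine Ideal.subset_span ⟨0, a, b, Nat.lt_of_lt_of_le Nat.zero_lt_one ht, hdist, ?_⟩
  rw [minor, entry_eq_var 𝕜 haw hal, entry_eq_var 𝕜 hbw hbl,
    entry_eq_var 𝕜 (p := p + 1) (by omega) (h3.trans hal),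
    entry_eq_var 𝕜 (p := p + 1) (by omega) (h4.trans hbl)]

/-! ### Primality of the two ideals -/

/-- The ideal is the kernel of the endomorphism `θ` killing the variables in `s` and fixing the
others: modulo the ideal, `θ` is the identity. -/
theorem isPrime_span_X_image {σ 𝕜 : Type*} [Field 𝕜] (s : Set σ) :
    (Ideal.span (X '' s : Set (MvPolynomial σ 𝕜))).IsPrime := by
  classical
  let θ : MvPolynomial σ 𝕜 →ₐ[𝕜] MvPolynomial σ 𝕜 := aeval fun i => if i ∈ s then 0 else X i
  suffices h : Ideal.span (X '' s : Set (MvPolynomial σ 𝕜)) = RingHom.ker θ by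
    rw [h]; exact RingHom.ker_isPrime _
  apply le_antisymm
  · rw [Ideal.span_le]
    rintro _ ⟨i, hi, rfl⟩
    simp [θ, RingHom.mem_ker, hi]
  · intro f hf
    have hcomp : (Ideal.Quotient.mkₐ 𝕜 (Ideal.span (X '' s : Set (MvPolynomial σ 𝕜)))).comp θ =
        Ideal.Quotient.mkₐ 𝕜 _ := by
      refine algHom_ext fun i => ?_
      by_cases hi : i ∈ s
      · have : Ideal.Quotient.mk (Ideal.span (X '' s : Set (MvPolynomial σ 𝕜))) (X i) = 0 :=
          Ideal.Quotient.eq_zero_iff_mem.2 (Ideal.subset_span ⟨i, hi, rfl⟩)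
        simp [θ, hi, this]
      · simp [θ, hi]
    have := DFunLike.congr_fun hcomp f
    rw [AlgHom.comp_apply, (RingHom.mem_ker).1 hf, map_zero] at this
    exact Ideal.Quotient.eq_zero_iff_mem.1 this.symm

/-- The kernel of a monomial map is spanned by the binomials it contains. -/
theorem ker_aeval_monomial_le {σ τ 𝕜 : Type*} [Field 𝕜] (e : σ → τ →₀ ℕ)
    (J : Ideal (MvPolynomial σ 𝕜))
    (h : ∀ s t : Multiset σ, (s.map e).sum = (t.map e).sum →
      (s.map X).prod - (t.map X).prod ∈ J) :
    RingHom.ker (aeval (R := 𝕜) fun i => monomial (e i) (1 : 𝕜)) ≤ J := by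
  classical
  -- A partial inverse modulo `J`: an attained exponent goes to the class of any monomial above it,
  -- which is well defined by `h`. Its linear extension `G` composed with the monomial map is the
  -- quotient map, so the kernel lies in `J`.
  let g : (τ →₀ ℕ) → MvPolynomial σ 𝕜 ⧸ J := fun u =>
    if h : ∃ s : Multiset σ, (s.map e).sum = u then
      Ideal.Quotient.mk J (h.choose.map X).prod else 0
  have hg : ∀ s : Multiset σ, g (s.map e).sum = Ideal.Quotient.mk J (s.map X).prod := fun s => by
    have hs : ∃ s' : Multiset σ, (s'.map e).sum = (s.map e).sum := ⟨s, rfl⟩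
    simp only [g]
    rw [dif_pos hs]
    exact Ideal.Quotient.eq.2 (h _ _ hs.choose_spec)
  have hφ : ∀ s : Multiset σ, aeval (R := 𝕜) (fun i => monomial (e i) (1 : 𝕜)) (s.map X).prod =
      monomial (s.map e).sum 1 := fun s => by
    induction s using Multiset.induction with
    | empty => simp
    | cons a s ih =>
      rw [Multiset.map_cons, Multiset.prod_cons, map_mul, ih, aeval_X, monomial_mul, one_mul,
        Multiset.map_cons, Multiset.sum_cons]
  have hm : ∀ m : σ →₀ ℕ, monomial m (1 : 𝕜) = ((Finsupp.toMultiset m).map X).prod := fun m => by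
    rw [Finsupp.toMultiset_map, Finsupp.prod_toMultiset, monomial_eq, map_one, one_mul,
      Finsupp.prod_mapDomain_index (by simp) (by simp [pow_add])]
  let G := (basisMonomials τ 𝕜).constr 𝕜 g
  have hG : ∀ u, G (monomial u 1) = g u := fun u => (basisMonomials τ 𝕜).constr_basis 𝕜 g u
  have hcomp : G ∘ₗ (aeval (R := 𝕜) fun i => monomial (e i) (1 : 𝕜)).toLinearMap =
      (Ideal.Quotient.mkₐ 𝕜 J).toLinearMap := by
    refine (basisMonomials σ 𝕜).ext fun m => ?_
    simp only [coe_basisMonomials, LinearMap.comp_apply, AlgHom.toLinearMap_apply,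
      Ideal.Quotient.mkₐ_eq_mk]
    rw [hm, hφ, hG, hg]
  intro f hf
  have := LinearMap.congr_fun hcomp f
  rw [LinearMap.comp_apply, AlgHom.toLinearMap_apply, (RingHom.mem_ker).1 hf, map_zero] at this
  exact Ideal.Quotient.eq_zero_iff_mem.1 this.symm

/-- If a weight can be moved between any two variables modulo an ideal, then two monomials with
the same columns and the same total weight are congruent. -/
theorem prod_sub_prod_mem {σ 𝕜 : Type*} [Field 𝕜] (wt col : σ → ℕ) (lo hi : ℕ)
    (hlo : ∀ x, lo ≤ wt x) (hhi : ∀ x, wt x ≤ hi)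
    (hinj : ∀ x y, wt x = wt y → col x = col y → x = y) (J : Ideal (MvPolynomial σ 𝕜))
    (hJ : ∀ x y, wt x < hi → lo < wt y → ∃ x' y', wt x' = wt x + 1 ∧ col x' = col x ∧
      wt y' + 1 = wt y ∧ col y' = col y ∧ (X x * X y - X x' * X y' : MvPolynomial σ 𝕜) ∈ J)
    (s t : Multiset σ) (hcol : s.map col = t.map col) (hwt : (s.map wt).sum = (t.map wt).sum) :
    ((s.map X).prod - (t.map X).prod : MvPolynomial σ 𝕜) ∈ J := by
  -- Induction on the gap `j` between the weights of `x` and `y`: a unit is moved to `x` from a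
  -- factor of `s`. At gap zero `x = y` cancels, leaving products of `N` factors.
  have aux : ∀ (N : ℕ), (∀ s t : Multiset σ, Multiset.card s = N → s.map col = t.map col →
      (s.map wt).sum = (t.map wt).sum → ((s.map X).prod - (t.map X).prod : MvPolynomial σ 𝕜) ∈ J) →
      ∀ (j : ℕ) (x y : σ) (s t : Multiset σ), wt x + j = wt y → Multiset.card s = N →
      col x = col y → s.map col = t.map col →
      wt x + (s.map wt).sum = wt y + (t.map wt).sum →
      (X x * (s.map X).prod - X y * (t.map X).prod : MvPolynomial σ 𝕜) ∈ J := by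
    intro N ih j
    induction j with
    | zero =>
      intro x y s t hxy hs hc hst hw
      obtain rfl := hinj x y hxy hc
      rw [← mul_sub]
      exact J.mul_mem_left _ (ih s t hs hst (by omega))
    | succ j ihj =>
      intro x y s t hxy hs hc hst hw
      have hcard : Multiset.card s = Multiset.card t := by
        simpa using congrArg Multiset.card hst
      -- If all of `s` had weight `lo`, its total would be at most that of `t`, contradicting `wt x
      -- < wt y`.
      obtain ⟨z, hz, hzlo⟩ : ∃ z ∈ s, lo < wt z := by
        by_contra! hcon
        have h1 := Multiset.sum_le_card_nsmul (s.map wt) lo (by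
          simpa using hcon)
        have h2 := Multiset.card_nsmul_le_sum (s := t.map wt) (a := lo) (by
          simpa using fun a _ => hlo a)
        rw [Multiset.card_map] at h1 h2
        rw [hcard] at h1
        omega
      obtain ⟨s, rfl⟩ := Multiset.exists_cons_of_mem hz
      obtain ⟨x', z', hx', hcx', hz', hcz', hmem⟩ := hJ x z (by have := hhi y; omega) hzlo
      have h := ihj x' y (z' ::ₘ s) t (by omega) (by simpa using hs) (hcx'.trans hc)
        (by rw [← hst, Multiset.map_cons, Multiset.map_cons, hcz']) (by
          rw [Multiset.map_cons, Multiset.sum_cons] at hw ⊢; omega)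
      have h' := J.add_mem h (J.mul_mem_right (s.map X).prod hmem)
      convert h' using 1
      simp only [Multiset.map_cons, Multiset.prod_cons]
      ring
  induction hN : Multiset.card s generalizing s t with
  | zero =>
    obtain rfl := Multiset.card_eq_zero.1 hN
    obtain rfl : t = 0 := by simpa using hcol.symm
    simp
  | succ N ih =>
    obtain ⟨x, s, rfl⟩ := Multiset.card_pos_iff_exists_mem.1 (by omega : 0 < Multiset.card s) |>.imp
      fun _ h => Multiset.exists_cons_of_mem h
    obtain ⟨y, hy, hyx⟩ : ∃ y ∈ t, col y = col x := by
      rw [← Multiset.mem_map, ← hcol]; simp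
    obtain ⟨t, rfl⟩ := Multiset.exists_cons_of_mem hy
    simp only [Multiset.map_cons, Multiset.sum_cons, Multiset.prod_cons, Multiset.card_cons,
      hyx, Multiset.cons_inj_right] at hcol hwt hN ⊢
    have ih' := fun s t h1 h2 h3 => ih s t h2 h3 h1
    rcases le_total (wt x) (wt y) with hle | hle
    · exact aux N ih' (wt y - wt x) x y s t (by omega) (by omega) hyx.symm hcol hwt
    · have hcard : Multiset.card s = Multiset.card t := by
        simpa using congrArg Multiset.card hcol
      rw [← neg_mem_iff, neg_sub]
      exact aux N ih' (wt x - wt y) y x t s (by omega) (by omega) hyx hcol.symm hwt.symm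

/-- The exponent of the image of a variable in the parametrization `x_a ↦ T ^ weight a * y_c`,
where `c` is the last component of `a`. -/
noncomputable def expo {m : ℕ} {r : Fin (m + 1) → ℕ} (q : Quotient (sSetoid r m)) :
    Option ℕ →₀ ℕ :=
  Finsupp.single none (classWeight q) + Finsupp.single (some (classCol q)) 1

/-- The parametrization `x_a ↦ T ^ weight a * y_c`, where `c` is the last component of `a`. -/
noncomputable def param {m : ℕ} (𝕜 : Type*) [Field 𝕜] (r : Fin (m + 1) → ℕ) :
    Ring 𝕜 r m →ₐ[𝕜] MvPolynomial (Option ℕ) 𝕜 :=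
  aeval fun q => monomial (expo q) 1

theorem param_entry {m : ℕ} (𝕜 : Type*) [Field 𝕜] {r : Fin (m + 1) → ℕ} (a : Index r) :
    param 𝕜 r (entry 𝕜 r m a) = X none ^ weight a * X (some (a.1 (Fin.last m))) := by
  rw [param, entry, aeval_X, X_pow_eq_monomial, X, monomial_mul, one_mul]
  rfl

/-- With `sum_expo_some`, this recovers total weight and the multiset of columns from the image of a
monomial, as `prod_sub_prod_mem` requires. -/
theorem sum_expo_none {m : ℕ} {r : Fin (m + 1) → ℕ} (s : Multiset (Quotient (sSetoid r m))) :
    (s.map expo).sum none = (s.map classWeight).sum := by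
  induction s using Multiset.induction with
  | empty => simp
  | cons a s ih => simp [ih, expo]

theorem sum_expo_some {m : ℕ} {r : Fin (m + 1) → ℕ} (s : Multiset (Quotient (sSetoid r m)))
    (c : ℕ) : (s.map expo).sum (some c) = (s.map classCol).count c := by
  induction s using Multiset.induction with
  | empty => simp
  | cons a s ih =>
    simp [ih, expo, Multiset.count_cons, Finsupp.single_apply, add_comm, eq_comm]

/-- The generalized ideal is the toric ideal of the parametrization. -/
theorem generalizedIdeal_eq_ker {k : ℕ} (𝕜 : Type*) [Field 𝕜] (r : Fin (k + 3) → ℕ)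
    (hr : ∀ i, 2 ≤ r i) (t : ℕ) (ht : 1 ≤ t) :
    generalizedIdeal 𝕜 r (k + 2) t = RingHom.ker (param 𝕜 r) := by
  have hr1 : ∀ i, 1 ≤ r i := fun i => one_le_two.trans (hr i)
  apply le_antisymm
  · rw [generalizedIdeal, Ideal.span_le]
    rintro _ ⟨i, a, b, -, rfl⟩
    rw [SetLike.mem_coe, RingHom.mem_ker, minor, map_sub, map_mul, map_mul]
    exact minor_relation_of_geometric (fun a => param 𝕜 r (entry 𝕜 r (k + 2) a)) (X none)
      (fun c => X (some c)) (param_entry 𝕜) i a b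
  · refine ker_aeval_monomial_le expo _ fun s t' hst => ?_
    refine prod_sub_prod_mem classWeight classCol (k + 2) (∑ i : Fin (k + 2), r i.castSucc)
      ?_ ?_ ?_ _ ?_ s t' ?_ ?_
    · rintro ⟨a⟩
      exact le_weight a
    · rintro ⟨a⟩
      exact weight_le a
    · rintro ⟨a⟩ ⟨b⟩ hw hc
      exact Quotient.sound ((sEquiv_iff a b).2 ⟨hw, hc⟩)
    · rintro ⟨a⟩ ⟨b⟩ (ha : weight a < _) (hb : _ < weight b)
      have hac := a.2 (Fin.last _)
      have hbc := b.2 (Fin.last _)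
      obtain ⟨a', ha', haw⟩ := exists_index_weight r hr1 (weight a + 1) (a.1 (Fin.last _))
        hac.1 hac.2 ((le_weight a).trans (Nat.le_succ _)) ha
      obtain ⟨b', hb', hbw⟩ := exists_index_weight r hr1 (weight b - 1) (b.1 (Fin.last _))
        hbc.1 hbc.2 (by omega) (by have := weight_le b; omega)
      refine ⟨Quotient.mk _ a', Quotient.mk _ b', haw, ha', ?_, hb', ?_⟩
      · change weight b' + 1 = weight b
        omega
      · have h := var_exchange_mem_generalizedIdeal 𝕜 r hr t ht (weight a) (weight b) _ _
          (le_weight a) ha hb (weight_le b) hac.1 hac.2 hbc.1 hbc.2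
        rwa [← entry_eq_var 𝕜 rfl rfl, ← entry_eq_var 𝕜 rfl rfl, ← entry_eq_var 𝕜 haw ha',
          ← entry_eq_var 𝕜 hbw hb'] at h
    · ext c
      rw [← sum_expo_some, ← sum_expo_some, hst]
    · rw [← sum_expo_none, ← sum_expo_none, hst]

/-! ### Primes missing an interior variable -/

/-- A table whose columns satisfy the relations of three consecutive entries and whose pairs of
columns satisfy those of consecutive rows, is geometric as soon as it has a nonzero interior
entry. -/
theorem exists_geometric {K : Type*} [Field K] (y : ℕ → ℕ → K) (lo hi C : ℕ)
    (hdiag : ∀ p c, lo ≤ p → p + 2 ≤ hi → 1 ≤ c → c ≤ C →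
      y p c * y (p + 2) c = y (p + 1) c * y (p + 1) c)
    (hrow : ∀ p c d, lo ≤ p → p < hi → 1 ≤ c → c ≤ C → 1 ≤ d → d ≤ C →
      y p c * y (p + 1) d = y (p + 1) c * y p d)
    (p₀ c₀ : ℕ) (hp : lo < p₀) (hp' : p₀ < hi) (hc : 1 ≤ c₀) (hc' : c₀ ≤ C)
    (hne : y p₀ c₀ ≠ 0) :
    ∃ (z : K) (v : ℕ → K), ∀ p c, lo ≤ p → p ≤ hi → 1 ≤ c → c ≤ C → y p c = z ^ p * v c := by
  -- A zero next to a nonzero entry would make that entry's square vanish. Both neighbours are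
  -- needed, hence the interior starting row.
  have hup : ∀ j, p₀ + j ≤ hi → y (p₀ + j) c₀ ≠ 0 := by
    intro j
    induction j with
    | zero => exact fun _ => hne
    | succ j ih =>
      intro hj h
      have h1 := hdiag (p₀ + j - 1) c₀ (by omega) (by omega) hc hc'
      rw [show p₀ + j - 1 + 2 = p₀ + (j + 1) by omega,
        show p₀ + j - 1 + 1 = p₀ + j by omega, h, mul_zero] at h1
      exact ih (by omega) (mul_self_eq_zero.1 h1.symm)
  have hdown : ∀ j, lo + j ≤ p₀ → y (p₀ - j) c₀ ≠ 0 := by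
    intro j
    induction j with
    | zero => exact fun _ => hne
    | succ j ih =>
      intro hj h
      have h1 := hdiag (p₀ - (j + 1)) c₀ (by omega) (by omega) hc hc'
      rw [show p₀ - (j + 1) + 1 = p₀ - j by omega, h, zero_mul] at h1
      exact ih (by omega) (mul_self_eq_zero.1 h1.symm)
  have hall : ∀ p, lo ≤ p → p ≤ hi → y p c₀ ≠ 0 := fun p h1 h2 => by
    rcases le_total p₀ p with h | h
    · have := hup (p - p₀) (by omega)
      rwa [show p₀ + (p - p₀) = p by omega] at this
    · have := hdown (p₀ - p) (by omega)
      rwa [show p₀ - (p₀ - p) = p by omega] at this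
  have h0 := hall lo le_rfl (by omega)
  have h1 := hall (lo + 1) (by omega) (by omega)
  obtain ⟨z, hz⟩ : ∃ z, z = y (lo + 1) c₀ / y lo c₀ := ⟨_, rfl⟩
  have hz0 : z ≠ 0 := hz ▸ div_ne_zero h1 h0
  have hcol₀ : ∀ j, lo + j < hi → y (lo + j + 1) c₀ = z * y (lo + j) c₀ := by
    intro j
    induction j with
    | zero => intro _; rw [hz, add_zero, div_mul_cancel₀ _ h0]
    | succ j ih =>
      intro hj
      have h2 := hdiag (lo + j) c₀ (by omega) (by omega) hc hc'
      have h3 := ih (by omega)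
      apply mul_left_cancel₀ (hall (lo + j) (by omega) (by omega))
      rw [show lo + (j + 1) + 1 = lo + j + 2 by omega, h2, ← add_assoc]
      nth_rewrite 1 [h3]
      ring
  -- Other columns may contain zeros; the row relations with the nowhere vanishing column `c₀` still
  -- give them the ratio `z`.
  have hcol : ∀ c, 1 ≤ c → c ≤ C → ∀ j, lo + j ≤ hi → y (lo + j) c = z ^ j * y lo c := by
    intro c hc1 hc2 j
    induction j with
    | zero => intro _; simp
    | succ j ih =>
      intro hj
      have h2 := hrow (lo + j) c₀ c (by omega) (by omega) hc hc' hc1 hc2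
      rw [hcol₀ j (by omega), ih (by omega)] at h2
      apply mul_left_cancel₀ (hall (lo + j) (by omega) (by omega))
      rw [← add_assoc, h2]
      ring
  refine ⟨z, fun c => y lo c / z ^ lo, fun p c hp1 hp2 hc1 hc2 => ?_⟩
  obtain ⟨j, rfl⟩ := Nat.exists_eq_add_of_le hp1
  rw [hcol c hc1 hc2 j hp2, pow_add]
  field_simp

/-- A prime over the slice ideal that misses an interior variable contains the generalized
ideal. -/
theorem generalizedIdeal_le_of_var_notMem {k : ℕ} (𝕜 : Type*) [Field 𝕜] (r : Fin (k + 3) → ℕ)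
    (hr : ∀ i, 2 ≤ r i) (t : ℕ) (ht : 1 ≤ t) (Q : Ideal (Ring 𝕜 r (k + 2))) [Q.IsPrime]
    (hQ : sliceIdeal 𝕜 r (k + 2) t ≤ Q) (p c : ℕ)
    (hp : k + 2 < p) (hp' : p < ∑ i : Fin (k + 2), r i.castSucc)
    (hc : 1 ≤ c) (hc' : c ≤ r (Fin.last _)) (hv : var 𝕜 r p c ∉ Q) :
    generalizedIdeal 𝕜 r (k + 2) t ≤ Q := by
  -- The kernel of `ψ` is `Q`, and its target is a field, where ratios of entries make sense.
  let ψ : Ring 𝕜 r (k + 2) →+* FractionRing (Ring 𝕜 r (k + 2) ⧸ Q) :=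
    (algebraMap (Ring 𝕜 r (k + 2) ⧸ Q) _).comp (Ideal.Quotient.mk Q)
  have hψ : ∀ f, ψ f = 0 ↔ f ∈ Q := fun f => by
    rw [RingHom.comp_apply, FaithfulSMul.algebraMap_eq_zero_iff, Ideal.Quotient.eq_zero_iff_mem]
  obtain ⟨z, v, hzv⟩ := exists_geometric (fun p c => ψ (var 𝕜 r p c)) (k + 2)
    (∑ i : Fin (k + 2), r i.castSucc) (r (Fin.last _))
    (fun p c h1 h2 h3 h4 => by
      have h := (hψ _).2 (hQ (var_diag_mem_sliceIdeal 𝕜 r hr t ht p c h1 h2 h3 h4))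
      rwa [map_sub, map_mul, map_mul, sub_eq_zero] at h)
    (fun p c d h1 h2 h3 h4 h5 h6 => by
      have h := (hψ _).2 (hQ (var_row_mem_sliceIdeal 𝕜 r hr t ht p c d h1 h2 h3 h4 h5 h6))
      rwa [map_sub, map_mul, map_mul, sub_eq_zero] at h)
    p c hp hp' hc hc' (mt (hψ _).1 hv)
  rw [generalizedIdeal, Ideal.span_le]
  rintro _ ⟨i, a, b, -, rfl⟩
  rw [SetLike.mem_coe, ← hψ, minor, map_sub, map_mul, map_mul]
  refine minor_relation_of_geometric (fun a => ψ (entry 𝕜 r (k + 2) a)) z v (fun a => ?_) i a b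
  rw [entry_eq_var 𝕜 (rfl : weight a = weight a) rfl]
  exact hzv _ _ (le_weight a) (weight_le a) (a.2 _).1 (a.2 _).2

/-! ### The monomial prime contains the slice ideal -/

/-- Termwise bounds are all attained exactly when the sum is extremal. With `forall_eq_bound_iff`,
this turns the two corners into the two extreme rows. -/
theorem forall_eq_one_iff {m : ℕ} {r : Fin (m + 1) → ℕ} (a : Index r) :
    (∀ i : Fin (m + 1), i.val < m → a.1 i = 1) ↔ weight a = m := by
  have h := Finset.sum_eq_sum_iff_of_le
    fun (i : Fin m) (_ : i ∈ Finset.univ) => (a.2 i.castSucc).1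
  rw [Finset.sum_const, Finset.card_univ, Fintype.card_fin, smul_eq_mul, mul_one] at h
  rw [eq_comm, weight, h]
  exact ⟨fun h i _ => (h _ i.2).symm,
    fun h i hi => (h ⟨i, hi⟩ (Finset.mem_univ _)).symm⟩

theorem forall_eq_bound_iff {m : ℕ} {r : Fin (m + 1) → ℕ} (a : Index r) :
    (∀ i : Fin (m + 1), i.val < m → a.1 i = r i) ↔ weight a = ∑ i : Fin m, r i.castSucc := by
  rw [weight, Finset.sum_eq_sum_iff_of_le
    fun (i : Fin m) (_ : i ∈ Finset.univ) => (a.2 i.castSucc).2]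
  exact ⟨fun h i _ => h _ i.2, fun h i hi => h ⟨i, hi⟩ (Finset.mem_univ _)⟩

theorem monomialIdeal_eq_span {m : ℕ} (𝕜 : Type*) [Field 𝕜] (r : Fin (m + 1) → ℕ) :
    monomialIdeal 𝕜 r m = Ideal.span (X '' {q : Quotient (sSetoid r m) |
      classWeight q ≠ m ∧ classWeight q ≠ ∑ i : Fin m, r i.castSucc}) := by
  rw [monomialIdeal]
  congr 1
  ext f
  constructor
  · rintro ⟨a, h1, h2, rfl⟩
    rw [forall_eq_one_iff] at h1
    rw [forall_eq_bound_iff] at h2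
    exact ⟨Quotient.mk _ a, ⟨h1, h2⟩, rfl⟩
  · rintro ⟨⟨a⟩, ⟨h1, h2⟩, rfl⟩
    exact ⟨a, mt (forall_eq_one_iff a).1 h1, mt (forall_eq_bound_iff a).1 h2, rfl⟩

theorem entry_mem_monomialIdeal_iff {m : ℕ} (𝕜 : Type*) [Field 𝕜] (r : Fin (m + 1) → ℕ)
    (a : Index r) : entry 𝕜 r m a ∈ monomialIdeal 𝕜 r m ↔
      weight a ≠ m ∧ weight a ≠ ∑ i : Fin m, r i.castSucc := by
  classical
  rw [monomialIdeal_eq_span, mem_ideal_span_X_image, entry, support_X]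
  simp only [Finset.mem_singleton, forall_eq, Finsupp.single_apply, ne_eq, ite_eq_right_iff,
    one_ne_zero, imp_false, not_not, exists_eq_right']
  rfl

theorem dist_le_one {m : ℕ} {r : Fin (m + 1) → ℕ} (a b : Index r)
    (h : ∀ i : Fin (m + 1), i.val < m → a.1 i = b.1 i) : dist a b ≤ 1 := by
  rw [dist, hammingDist]
  refine (Finset.card_le_card fun i hi => ?_).trans (Finset.card_singleton (Fin.last m)).le
  rw [Finset.mem_filter] at hi
  rw [Finset.mem_singleton]
  by_contra hne
  exact hi.2 (h i (Fin.lt_last_iff_ne_last.2 hne))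

theorem le_dist {m : ℕ} {r : Fin (m + 1) → ℕ} (a b : Index r)
    (h : ∀ i : Fin (m + 1), i.val < m → a.1 i ≠ b.1 i) : m ≤ dist a b := by
  rw [dist, hammingDist]
  calc m = (Finset.univ.map Fin.castSuccEmb : Finset (Fin (m + 1))).card := by simp
    _ ≤ _ := Finset.card_le_card fun i hi => by
      obtain ⟨j, -, rfl⟩ := Finset.mem_map.1 hi
      exact Finset.mem_filter.2 ⟨Finset.mem_univ _, h _ j.2⟩

theorem dist_switch {n : ℕ} {r : Fin n → ℕ} (L : Finset (Fin n)) (a b : Index r) :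
    dist (switch L a b) (switch L b a) = dist a b := by
  unfold dist hammingDist
  congr 1
  ext i
  by_cases h : i ∈ L <;> simp [switch, h, eq_comm]

/-- Otherwise both indices are corners. Equal corners give distance at most 1, and opposite ones at
least `m ≥ 3` because every `r i ≥ 2`. -/
theorem entry_mul_entry_mem_monomialIdeal {m : ℕ} (hm : 3 ≤ m) (𝕜 : Type*) [Field 𝕜]
    (r : Fin (m + 1) → ℕ) (hr : ∀ i, 2 ≤ r i) (a b : Index r) (h : dist a b = 2) :
    entry 𝕜 r m a * entry 𝕜 r m b ∈ monomialIdeal 𝕜 r m := by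
  by_contra hcon
  have ha := mt (Ideal.mul_mem_right (entry 𝕜 r m b) _) hcon
  have hb := mt (Ideal.mul_mem_left _ (entry 𝕜 r m a)) hcon
  rw [entry_mem_monomialIdeal_iff, not_and_or, not_not, not_not, ← forall_eq_one_iff,
    ← forall_eq_bound_iff] at ha hb
  rcases ha with ha | ha <;> rcases hb with hb | hb
  · have := dist_le_one a b fun i hi => (ha i hi).trans (hb i hi).symm
    omega
  · have := le_dist a b fun i hi => by
      rw [ha i hi, hb i hi]; have := hr i; omega
    omega
  · have := le_dist a b fun i hi => by
      rw [ha i hi, hb i hi]; have := hr i; omega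
    omega
  · have := dist_le_one a b fun i hi => (ha i hi).trans (hb i hi).symm
    omega

theorem sliceIdeal_le_monomialIdeal {m : ℕ} (hm : 3 ≤ m) (𝕜 : Type*) [Field 𝕜]
    (r : Fin (m + 1) → ℕ) (hr : ∀ i, 2 ≤ r i) (t : ℕ) :
    sliceIdeal 𝕜 r m t ≤ monomialIdeal 𝕜 r m := by
  rw [sliceIdeal, Ideal.span_le]
  rintro _ ⟨i, a, b, -, h, rfl⟩
  exact Ideal.sub_mem _ (entry_mul_entry_mem_monomialIdeal hm 𝕜 r hr a b h)
    (entry_mul_entry_mem_monomialIdeal hm 𝕜 r hr _ _ ((dist_switch _ a b).trans h))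

theorem sliceIdeal_le_generalizedIdeal {n : ℕ} (𝕜 : Type*) [Field 𝕜] (r : Fin n → ℕ) (s t : ℕ) :
    sliceIdeal 𝕜 r s t ≤ generalizedIdeal 𝕜 r s t :=
  Ideal.span_mono fun _ ⟨i, a, b, hi, _, hf⟩ => ⟨i, a, b, hi, hf⟩

/-! ### Determination of the minimal primes -/

/-- The minimal primes over an ideal below two incomparable primes, when every prime over it
contains one of the two. -/
theorem minimalPrimes_eq_pair {R : Type*} [CommRing R] {I J P : Ideal R} (hJ : J.IsPrime)
    (hP : P.IsPrime) (hIJ : I ≤ J) (hIP : I ≤ P) (hJP : ¬ J ≤ P) (hPJ : ¬ P ≤ J)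
    (h : ∀ Q : Ideal R, Q.IsPrime → I ≤ Q → J ≤ Q ∨ P ≤ Q) : I.minimalPrimes = {J, P} := by
  ext Q
  constructor
  · rintro ⟨⟨hQ, hIQ⟩, hmin⟩
    rcases h Q hQ hIQ with h1 | h1
    · exact Or.inl (le_antisymm (hmin ⟨hJ, hIJ⟩ h1) h1)
    · exact Or.inr (le_antisymm (hmin ⟨hP, hIP⟩ h1) h1)
  · rintro (rfl | rfl)
    · refine ⟨⟨hJ, hIJ⟩, fun Q' ⟨hQ', hIQ'⟩ hle => ?_⟩
      exact (h Q' hQ' hIQ').resolve_right fun h' => hPJ (h'.trans hle)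
    · refine ⟨⟨hP, hIP⟩, fun Q' ⟨hQ', hIQ'⟩ hle => ?_⟩
      exact (h Q' hQ' hIQ').resolve_left fun h' => hJP (h'.trans hle)

theorem minimalPrimes_sliceIdeal {k : ℕ} (𝕜 : Type*) [Field 𝕜] (r : Fin (k + 4) → ℕ)
    (hr : ∀ i, 2 ≤ r i) (t : ℕ) (ht : 1 ≤ t) :
    (sliceIdeal 𝕜 r (k + 3) t).minimalPrimes =
        {generalizedIdeal 𝕜 r (k + 3) t, monomialIdeal 𝕜 r (k + 3)} ∧
      generalizedIdeal 𝕜 r (k + 3) t ≠ monomialIdeal 𝕜 r (k + 3) := by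
  have hr1 : ∀ i, 1 ≤ r i := fun i => one_le_two.trans (hr i)
  have hhi : 2 * (k + 3) ≤ ∑ i : Fin (k + 3), r i.castSucc := by
    simpa [mul_comm] using Finset.sum_le_sum
      fun (i : Fin (k + 3)) (_ : i ∈ Finset.univ) => hr i.castSucc
  have hker := generalizedIdeal_eq_ker 𝕜 r hr t ht
  have hJ : (generalizedIdeal 𝕜 r (k + 3) t).IsPrime := hker ▸ RingHom.ker_isPrime _
  have hP : (monomialIdeal 𝕜 r (k + 3)).IsPrime :=
    monomialIdeal_eq_span 𝕜 r ▸ isPrime_span_X_image _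
  have hmem : ∀ p, k + 3 ≤ p → p ≤ ∑ i : Fin (k + 3), r i.castSucc →
      (var 𝕜 r p 1 ∈ monomialIdeal 𝕜 r (k + 3) ↔
        p ≠ k + 3 ∧ p ≠ ∑ i : Fin (k + 3), r i.castSucc) := fun p h1 h2 => by
    obtain ⟨a, hac, haw⟩ := exists_index_weight r hr1 p 1 le_rfl (hr1 _) h1 h2
    rw [← entry_eq_var 𝕜 haw hac, entry_mem_monomialIdeal_iff, haw]
  -- The witness is `x_{lo} x_{hi} - x_{lo+1} x_{hi-1}` in column 1: its second product lies in `P`,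
  -- but neither factor of the first does.
  have hJP : ¬ generalizedIdeal 𝕜 r (k + 3) t ≤ monomialIdeal 𝕜 r (k + 3) := fun hle => by
    have h1 := hle (var_exchange_mem_generalizedIdeal 𝕜 r hr t ht (k + 3)
      (∑ i : Fin (k + 3), r i.castSucc) 1 1 le_rfl
      (lt_of_lt_of_le (by omega : k + 3 < 2 * (k + 3)) hhi)
      (lt_of_lt_of_le (by omega : k + 3 < 2 * (k + 3)) hhi) le_rfl
      le_rfl (hr1 _) le_rfl (hr1 _))
    have h2 := Ideal.mul_mem_right
      (var 𝕜 r (∑ i : Fin (k + 3), r i.castSucc - 1) 1) _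
      ((hmem (k + 3 + 1) (by omega) (by omega)).2 ⟨by omega, by omega⟩)
    rcases hP.mem_or_mem ((Submodule.sub_mem_iff_left _ h2).1 h1) with h | h
    · exact ((hmem _ le_rfl (by omega)).1 h).1 rfl
    · exact ((hmem _ (by omega) le_rfl).1 h).2 rfl
  -- The parametrization sends every variable to a nonzero monomial, so the variable in row `lo + 1`
  -- is not in its kernel.
  have hPJ : ¬ monomialIdeal 𝕜 r (k + 3) ≤ generalizedIdeal 𝕜 r (k + 3) t := fun hle => by
    have h1 := hle ((hmem (k + 4) (by omega) (by omega)).2 ⟨by omega, by omega⟩)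
    obtain ⟨a, hac, haw⟩ := exists_index_weight r hr1 (k + 4) 1 le_rfl (hr1 _)
      (by omega) (by omega)
    rw [← entry_eq_var 𝕜 haw hac, hker, RingHom.mem_ker, param_entry] at h1
    exact mul_ne_zero (pow_ne_zero _ (X_ne_zero _)) (X_ne_zero _) h1
  refine ⟨minimalPrimes_eq_pair hJ hP (sliceIdeal_le_generalizedIdeal 𝕜 r _ t)
    (sliceIdeal_le_monomialIdeal (by omega) 𝕜 r hr t) hJP hPJ fun Q hQ hIQ => ?_,
    fun h => hJP h.le⟩
  refine or_iff_not_imp_right.2 fun hPQ => ?_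
  rw [monomialIdeal_eq_span, Ideal.span_le, Set.not_subset] at hPQ
  obtain ⟨_, ⟨⟨a⟩, ⟨h1, h2⟩, rfl⟩, hv⟩ := hPQ
  change weight a ≠ _ at h1
  change weight a ≠ _ at h2
  change entry 𝕜 r (k + 3) a ∉ Q at hv
  rw [entry_eq_var 𝕜 (rfl : weight a = weight a) rfl] at hv
  exact generalizedIdeal_le_of_var_notMem 𝕜 r hr t ht Q hIQ _ _
    (lt_of_le_of_ne (le_weight a) h1.symm) (lt_of_le_of_ne (weight_le a) h2)
    (a.2 _).1 (a.2 _).2 hv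

end SHankel

theorem mainTheorem10 {𝕜 : Type*} [Field 𝕜] (n : ℕ) (hn : 4 ≤ n) (r : Fin n → ℕ)
    (hr : ∀ i, 2 ≤ r i) (t : ℕ) (ht : 1 ≤ t) (htn : t ≤ n) :
    (SHankel.sliceIdeal 𝕜 r (n - 1) t).minimalPrimes =
        {SHankel.generalizedIdeal 𝕜 r (n - 1) t, SHankel.monomialIdeal 𝕜 r (n - 1)} ∧
      SHankel.generalizedIdeal 𝕜 r (n - 1) t ≠ SHankel.monomialIdeal 𝕜 r (n - 1) := by
  -- For `n = k + 4`, the number `n - 1` is `k + 3` by definition.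
  obtain ⟨k, rfl⟩ := Nat.exists_eq_add_of_le' hn
  exact SHankel.minimalPrimes_sliceIdeal 𝕜 r hr t ht
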